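/- Let $\Sigma$ be a finite alphabet. A boundary position is a symbol $\triangleright_a$ or $\triangleleft_a$ with $a\in\Sigma$. On a word $w=w_1\cdots w_\ell$, $\triangleright_a(w)$ is the first and $\triangleleft_a(w)$ the last position carrying the letter $a$; relative to a position $q$, $\triangleright_a(w,q)$ is the first $a$-position strictly to the right of $q$ and $\triangleleft_a(w,q)$ the last $a$-position strictly to the left of $q$; each is undefined if there is no such position. For $n\ge 1$, an $n$-ranker is a sequence $r=(p_1,\dots,p_n)$ of boundary positions; its value $r(w)$ is obtained by evaluating $p_1$ on $w$ and then each $p_{k+1}$ relative to the position reached by $(p_1,\dots,p_k)$, and is undefined if any of these steps is undefined. An $(i,j)$-ranker is a $j$-ranker whose sequence of directions consists of exactly $i$ maximal blocks of equal directions ($\triangleright$ or $\triangleleft$). Let $R^\star_{m,n}(w)$ be the set of all $(i,j)$-rankers with $1\le i\le m$, $1\le j\le n$ that are defined on $w$ (so it is empty if $m\le 0$ or $n\le 0$). For positions $i,j$ let $\mathrm{ord}(i,j)\in\{<,=,>\}$ be their order type. Write $u\equiv^2_{m,n}v$ if $u$ and $v$ satisfy the same sentences of first-order logic over words with the predicates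 $<$, $=$ and $Q_a$ ($a\in\Sigma$) that use at most two distinct variables, have quantifier depth at most $n$, and have at most $m$ blocks of alternating quantifiers on every path of the parse tree (where a quantifier in the scope of an odd number of negations counts as its dual). Theorem. Let $u,v\in\Sigma^\star$ be finite words and let $m,n\in\mathbb N$ with $m\le n$. Then $u\equiv^2_{m,n}v$ if and only if all of the following hold: (a) $R^\star_{m,n}(u)=R^\star_{m,n}(v)$; (b) for all $r\in R^\star_{m,n}(u)$ and all $r'\in R^\star_{m-1,n-1}(u)$, $\mathrm{ord}(r(u),r'(u))=\mathrm{ord}(r(v),r'(v))$; (c) for all $r\in R^\star_{m,n}(u)$ and all $r'\in R^\star_{m,n-1}(u)$ whose last boundary positions have different directions, $\mathrm{ord}(r(u),r'(u))=\mathrm{ord}(r(v),r'(v))$. -/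

import Mathlib

namespace FO2

/-! Words over `α` are lists. The positions of a word `w` are numbered `0, …, w.length - 1`, and
`w[i]? = some a` says that `i` is a position of `w` that carries the letter `a`. -/

/-! ### Formulas of two-variable first-order logic with order on words -/

/-- The two quantifiers. -/
inductive Quant
  | ex
  | all
  deriving DecidableEq

/-- The other quantifier. -/
def Quant.dual : Quant → Quant
  | Quant.ex => Quant.all
  | Quant.all => Quant.ex

/-- First-order formulas over the letter predicates `Q_a` (`a : α`), `<` and `=`, with the
elements of `Fin 2` as the only two variables (which may be requantified). -/
inductive Formula (α : Type*)
  | letter (a : α) (x : Fin 2)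
  | lt (x y : Fin 2)
  | eq (x y : Fin 2)
  | neg (φ : Formula α)
  | and (φ ψ : Formula α)
  | or (φ ψ : Formula α)
  | quant (Q : Quant) (x : Fin 2) (φ : Formula α)

namespace Formula

variable {α : Type*}

/-- The free variables of a formula. -/
def freeVars : Formula α → Finset (Fin 2)
  | letter _ x => {x}
  | lt x y => {x, y}
  | eq x y => {x, y}
  | neg φ => φ.freeVars
  | and φ ψ => φ.freeVars ∪ ψ.freeVars
  | or φ ψ => φ.freeVars ∪ ψ.freeVars
  | quant _ x φ => φ.freeVars.erase x

/-- The quantifier depth of a formula. -/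
def depth : Formula α → ℕ
  | letter _ _ => 0
  | lt _ _ => 0
  | eq _ _ => 0
  | neg φ => φ.depth
  | and φ ψ => max φ.depth ψ.depth
  | or φ ψ => max φ.depth ψ.depth
  | quant _ _ φ => φ.depth + 1

/-- Auxiliary count for `blocks`. The flag `pos` records whether the subformula stands under an
even number of negations, and `last` is the innermost quantifier above the subformula on the
current path, if any. As usual, a quantifier under an odd number of negations counts as its dual
(as it would after pushing the negations down to the atoms). A quantifier opens a new block unless
it agrees with the quantifier above it. -/
def blocksAux : Formula α → (pos : Bool) → (last : Option Quant) → ℕ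
  | letter _ _, _, _ => 0
  | lt _ _, _, _ => 0
  | eq _ _, _, _ => 0
  | neg φ, pos, last => φ.blocksAux (!pos) last
  | and φ ψ, pos, last => max (φ.blocksAux pos last) (ψ.blocksAux pos last)
  | or φ ψ, pos, last => max (φ.blocksAux pos last) (ψ.blocksAux pos last)
  | quant Q _ φ, pos, last =>
      let Q' := if pos then Q else Q.dual
      (if last = some Q' then 0 else 1) + φ.blocksAux pos (some Q')

/-- The maximal number of blocks of alternating quantifiers on a path of the parse tree. -/
def blocks (φ : Formula α) : ℕ :=
  φ.blocksAux true none

/-- Truth of a formula in the word `w` under the assignment `s` of positions to the variables.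
Quantifiers range over the positions of `w`. -/
def Holds (w : List α) : (Fin 2 → ℕ) → Formula α → Prop
  | s, letter a x => w[s x]? = some a
  | s, lt x y => s x < s y
  | s, eq x y => s x = s y
  | s, neg φ => ¬ Holds w s φ
  | s, and φ ψ => Holds w s φ ∧ Holds w s ψ
  | s, or φ ψ => Holds w s φ ∨ Holds w s ψ
  | s, quant Quant.ex x φ => ∃ i, i < w.length ∧ Holds w (Function.update s x i) φ
  | s, quant Quant.all x φ => ∀ i, i < w.length → Holds w (Function.update s x i) φ

end Formula

/-- Truth of a sentence in a word. By default both variables are set to the first position; the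
truth value of a sentence does not depend on this. -/
def Models {α : Type*} (w : List α) (φ : Formula α) : Prop :=
  φ.Holds w fun _ => 0

/-- The sentences of two-variable logic of quantifier depth at most `n` in which every path of the
parse tree has at most `m` blocks of alternating quantifiers. -/
def SentencesFO2 (α : Type*) (m n : ℕ) : Set (Formula α) :=
  {φ | φ.freeVars = ∅ ∧ φ.blocks ≤ m ∧ φ.depth ≤ n}

/-- The relation `u ≡²_{m,n} v`. -/
def Equiv2 {α : Type*} (m n : ℕ) (u v : List α) : Prop :=
  ∀ φ ∈ SentencesFO2 α m n, Models u φ ↔ Models v φ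

/-! ### Rankers -/

/-- The directions of boundary positions: `right` is `▷` (first occurrence, scanning rightwards),
`left` is `◁` (last occurrence, scanning leftwards). -/
inductive Dir
  | right
  | left
  deriving DecidableEq

/-- A boundary position, given by a direction and a letter. -/
structure BoundaryPos (α : Type*) where
  dir : Dir
  letter : α

/-- The least position of `w` that satisfies `P` and carries the letter `a`, if there is one. -/
def leastPos {α : Type*} [DecidableEq α] (w : List α) (a : α) (P : ℕ → Bool) : Option ℕ :=
  (List.range w.length).find? fun i => P i && decide (w[i]? = some a)

/-- The greatest position of `w` that satisfies `P` and carries the letter `a`, if there is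
one. -/
def greatestPos {α : Type*} [DecidableEq α] (w : List α) (a : α) (P : ℕ → Bool) : Option ℕ :=
  (List.range w.length).reverse.find? fun i => P i && decide (w[i]? = some a)

/-- The first, respectively last, occurrence in `w` of the letter of a boundary position. -/
def BoundaryPos.eval {α : Type*} [DecidableEq α] (w : List α) (p : BoundaryPos α) : Option ℕ :=
  match p.dir with
  | Dir.right => leastPos w p.letter fun _ => true
  | Dir.left => greatestPos w p.letter fun _ => true

/-- The first occurrence of the letter strictly to the right of `q`, respectively the last
occurrence strictly to the left of `q`. -/
def BoundaryPos.evalFrom {α : Type*} [DecidableEq α] (w : List α) (q : ℕ) (p : BoundaryPos α) :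
    Option ℕ :=
  match p.dir with
  | Dir.right => leastPos w p.letter fun i => decide (q < i)
  | Dir.left => greatestPos w p.letter fun i => decide (i < q)

/-- An `n`-ranker is a list of `n ≥ 1` boundary positions. -/
abbrev Ranker (α : Type*) := List (BoundaryPos α)

namespace Ranker

variable {α : Type*}

/-- The value `r(w)` of the ranker `r = (p₁, …, pₙ)` on the word `w`, where `none` means
undefined: `p₁` is evaluated on `w`, and each further `pₖ` relative to the position reached. -/
def eval [DecidableEq α] (r : Ranker α) (w : List α) : Option ℕ :=
  match r with
  | [] => none
  | p :: ps => ps.foldl (fun o p' => o.bind fun q => p'.evalFrom w q) (p.eval w)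

/-- The number of maximal blocks of boundary positions with equal direction. -/
def blocks : Ranker α → ℕ
  | [] => 0
  | [_] => 1
  | p :: q :: ps => (if p.dir = q.dir then 0 else 1) + blocks (q :: ps)

/-- The direction of the last boundary position (`none` only for the empty list). -/
def lastDir (r : Ranker α) : Option Dir :=
  r.getLast?.map BoundaryPos.dir

end Ranker

/-- `R_{m,n}(w)`: the rankers of length exactly `n` with exactly `m` blocks that are defined
over `w`. -/
def rankers {α : Type*} [DecidableEq α] (m n : ℕ) (w : List α) : Set (Ranker α) :=
  {r | r.length = n ∧ r.blocks = m ∧ (r.eval w).isSome}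

/-- `R*_{m,n}(w)`, the union of the sets `R_{i,j}(w)` for `1 ≤ i ≤ m` and `1 ≤ j ≤ n`. -/
def rankersStar {α : Type*} [DecidableEq α] (m n : ℕ) (w : List α) : Set (Ranker α) :=
  ⋃ i ∈ Set.Icc 1 m, ⋃ j ∈ Set.Icc 1 n, rankers i j w

/-- The order type of `r(w)` and `r'(w)`; it is `none` if one of the two is undefined. -/
def ordOn {α : Type*} [DecidableEq α] (w : List α) (r r' : Ranker α) : Option Ordering :=
  Option.map₂ compare (r.eval w) (r'.eval w)

end FO2

/-! Conditions (a)-(c) are packaged as `Agree`. A comparison "x lies beyond r in direction d" costs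
as many blocks as r extended by one more step in direction d (`Ranker.extBlocks`). Read this way,
(b) and (c) become one condition: when r ends in direction d, r' may be compared with r exactly when
r' extended against d has at most m blocks.

From logic to rankers: being beyond a defined ranker is expressed by a formula (`holds_beyond`)
whose quantifiers alternate exactly where the ranker changes direction (`blocksAux_beyond`). The
value of r followed by an a-step in direction d is the first a beyond r. Hence its definedness, and
its position relative to r', amount to the existence of an a between r and r' (`between`), a
sentence within the budget.

From rankers to logic: a one-sided Ehrenfeucht-Fraïssé argument. The invariant `Sim` carries
comparisons with rankers from u to v only; reversing its direction negates them and costs one block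
(`Sim.swap`), which pays for a quantifier alternation. The core is `Agree.exists_sim`: each position
of u has a match in v that is itself a ranker value. As that ranker lies on a known side of the
position, the old invariant also orders the match correctly against the pebble left in place
(`Sim.forth`). -/

namespace FO2

/-! ### Directions and the orders they induce -/

/-- The opposite direction. -/
def Dir.flip : Dir → Dir
  | Dir.right => Dir.left
  | Dir.left => Dir.right

/-- The order in which positions are met when scanning in direction `d`, strict or weak. -/
def Dir.rel : Dir → (strict : Bool) → ℕ → ℕ → Prop
  | Dir.right, true, i, j => i < j
  | Dir.right, false, i, j => i ≤ j
  | Dir.left, true, i, j => j < i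
  | Dir.left, false, i, j => j ≤ i

theorem Dir.eq_flip_of_ne {d e : Dir} (h : e ≠ d) : d = e.flip := by
  cases d <;> cases e <;> simp_all [Dir.flip]

theorem Dir.flip_ne (d : Dir) : d.flip ≠ d := by
  cases d <;> simp [Dir.flip]

theorem Dir.not_rel {d : Dir} {s : Bool} {i j : ℕ} : ¬ d.rel s i j ↔ d.rel (!s) j i := by
  cases d <;> cases s <;> simp [Dir.rel]

theorem Dir.flip_rel {d : Dir} {s : Bool} {i j : ℕ} : d.flip.rel s i j ↔ d.rel s j i := by
  cases d <;> cases s <;> simp [Dir.rel, Dir.flip]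

theorem Dir.rel.trans {d : Dir} {s t : Bool} {i j k : ℕ} (h : d.rel s i j) (h' : d.rel t j k) :
    d.rel (s || t) i k := by
  cases d <;> cases s <;> cases t <;> simp [Dir.rel] at * <;> omega

theorem Dir.rel.weaken {d : Dir} {s : Bool} {i j : ℕ} (h : d.rel s i j) : d.rel false i j := by
  cases d <;> cases s <;> simp [Dir.rel] at * <;> omega

theorem Dir.rel_refl (d : Dir) (i : ℕ) : d.rel false i i := by
  cases d <;> simp [Dir.rel]

theorem Dir.rel_antisymm {d : Dir} {i j : ℕ} (h : d.rel false i j) (h' : d.rel false j i) :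
    i = j := by
  cases d <;> simp [Dir.rel] at * <;> omega

theorem Dir.rel_or_eq {d : Dir} {i j : ℕ} (h : d.rel false i j) : d.rel true i j ∨ i = j := by
  cases d <;> simp [Dir.rel] at * <;> omega

theorem Dir.exists_rel_of_ne {i j : ℕ} (h : i ≠ j) : ∃ d : Dir, d.rel true i j := by
  rcases Nat.lt_or_gt_of_ne h with h | h
  · exact ⟨Dir.right, h⟩
  · exact ⟨Dir.left, h⟩

theorem compare_eq_compare_iff {i i' j j' : ℕ} :
    compare i i' = compare j j' ↔ ((i < i' ↔ j < j') ∧ (i ≤ i' ↔ j ≤ j')) := by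
  simp only [Nat.compare_eq_ite_lt]
  split_ifs <;> simp <;> omega

/-- The strict and the weak comparison in one fixed direction already determine the order type, so
neither side has to be treated separately. -/
theorem compare_eq_compare_iff_rel {d : Dir} {i i' j j' : ℕ} :
    compare i i' = compare j j' ↔ ∀ s, (d.rel s i i' ↔ d.rel s j j') := by
  rw [compare_eq_compare_iff, Bool.forall_bool]
  cases d <;> simp only [Dir.rel] <;> omega

theorem compare_swap_eq {i i' j j' : ℕ} (h : compare i i' = compare j j') :
    compare i' i = compare j' j := by
  rw [compare_eq_compare_iff] at *
  omega

/-- A maximal element in direction `d` of a nonempty bounded set of positions. -/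
theorem Dir.exists_max (d : Dir) (P : ℕ → Prop) {N : ℕ} (hN : ∀ j, P j → j < N)
    (hP : ∃ j, P j) : ∃ j, P j ∧ ∀ k, P k → d.rel false k j := by
  classical
  cases d with
  | right =>
    have hne : ((Finset.range N).filter P).Nonempty := by
      obtain ⟨j, hj⟩ := hP
      exact ⟨j, by simp [hj, hN j hj]⟩
    refine ⟨_, (Finset.mem_filter.1 (Finset.max'_mem _ hne)).2, fun k hk => ?_⟩
    exact Finset.le_max' _ _ (by simp [hk, hN k hk])
  | left => exact ⟨Nat.find hP, Nat.find_spec hP, fun k hk => Nat.find_min' hP hk⟩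

/-! ### Evaluation of rankers -/

theorem find?_eq_some_iff_of_pairwise {d : Dir} {l : List ℕ} (hl : l.Pairwise (d.rel true))
    {p : ℕ → Bool} {i : ℕ} :
    l.find? p = some i ↔ i ∈ l ∧ p i ∧ ∀ j ∈ l, p j → d.rel false i j := by
  have key : ∀ k, l.find? p = some k → ∀ j ∈ l, p j → d.rel false k j := by
    intro k hk j hj hpj
    obtain ⟨-, as, bs, rfl, has⟩ := List.find?_eq_some_iff_append.1 hk
    rcases List.mem_append.1 hj with hj | hj
    · simpa [hpj] using has j hj
    · rcases List.mem_cons.1 hj with rfl | hj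
      · exact d.rel_refl _
      · have := (List.pairwise_append.1 hl).2.1
        exact ((List.pairwise_cons.1 this).1 j hj).weaken
  constructor
  · intro h
    exact ⟨List.mem_of_find?_eq_some h, List.find?_some h, key i h⟩
  · rintro ⟨hi, hpi, hmin⟩
    cases hk : l.find? p with
    | none => exact absurd hpi (by simpa using List.find?_eq_none.1 hk i hi)
    | some k =>
      rw [Dir.rel_antisymm (key k hk i hi hpi)
        (hmin k (List.mem_of_find?_eq_some hk) (List.find?_some hk))]

variable {α : Type*}

theorem lt_length_of_getElem? {w : List α} {i : ℕ} {a : α} (h : w[i]? = some a) :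
    i < w.length :=
  (List.getElem?_eq_some_iff.1 h).1

section Eval

variable [DecidableEq α]

theorem leastPos_eq_some_iff {w : List α} {a : α} {P : ℕ → Bool} {i : ℕ} :
    leastPos w a P = some i ↔
      w[i]? = some a ∧ P i ∧ ∀ j, w[j]? = some a → P j → Dir.right.rel false i j := by
  have hl : (List.range w.length).Pairwise (Dir.right.rel true) := List.pairwise_lt_range
  rw [leastPos, find?_eq_some_iff_of_pairwise hl]
  simp only [List.mem_range, Bool.and_eq_true, decide_eq_true_eq]
  constructor
  · rintro ⟨-, ⟨h1, h2⟩, h3⟩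
    exact ⟨h2, h1, fun j hj hP => h3 j (lt_length_of_getElem? hj) ⟨hP, hj⟩⟩
  · rintro ⟨h1, h2, h3⟩
    exact ⟨lt_length_of_getElem? h1, ⟨h2, h1⟩, fun j _ hj => h3 j hj.2 hj.1⟩

theorem greatestPos_eq_some_iff {w : List α} {a : α} {P : ℕ → Bool} {i : ℕ} :
    greatestPos w a P = some i ↔
      w[i]? = some a ∧ P i ∧ ∀ j, w[j]? = some a → P j → Dir.left.rel false i j := by
  have hl : (List.range w.length).reverse.Pairwise (Dir.left.rel true) :=
    List.pairwise_reverse.2 List.pairwise_lt_range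
  rw [greatestPos, find?_eq_some_iff_of_pairwise hl]
  simp only [List.mem_reverse, List.mem_range, Bool.and_eq_true, decide_eq_true_eq]
  constructor
  · rintro ⟨-, ⟨h1, h2⟩, h3⟩
    exact ⟨h2, h1, fun j hj hP => h3 j (lt_length_of_getElem? hj) ⟨hP, hj⟩⟩
  · rintro ⟨h1, h2, h3⟩
    exact ⟨lt_length_of_getElem? h1, ⟨h2, h1⟩, fun j _ hj => h3 j hj.2 hj.1⟩

theorem BoundaryPos.eval_eq_some_iff {w : List α} {p : BoundaryPos α} {i : ℕ} :
    p.eval w = some i ↔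
      w[i]? = some p.letter ∧ ∀ j, w[j]? = some p.letter → p.dir.rel false i j := by
  obtain ⟨d, a⟩ := p
  cases d <;>
    simp [BoundaryPos.eval, leastPos_eq_some_iff, greatestPos_eq_some_iff]

theorem BoundaryPos.evalFrom_eq_some_iff {w : List α} {q : ℕ} {p : BoundaryPos α} {i : ℕ} :
    p.evalFrom w q = some i ↔ w[i]? = some p.letter ∧ p.dir.rel true q i ∧
      ∀ j, w[j]? = some p.letter → p.dir.rel true q j → p.dir.rel false i j := by
  obtain ⟨d, a⟩ := p
  cases d <;>
    simp [BoundaryPos.evalFrom, leastPos_eq_some_iff, greatestPos_eq_some_iff, Dir.rel]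

theorem Ranker.eval_concat {r : Ranker α} (hr : r ≠ []) (p : BoundaryPos α) (w : List α) :
    Ranker.eval (r ++ [p]) w = (r.eval w).bind fun q => p.evalFrom w q := by
  cases r with
  | nil => exact absurd rfl hr
  | cons q qs => simp [Ranker.eval, List.foldl_append]

/-- `q` lies beyond `r(w)` in direction `d`, strictly or weakly. The empty ranker imposes no
condition. -/
def Past (w : List α) (d : Dir) (s : Bool) (r : Ranker α) (q : ℕ) : Prop :=
  r = [] ∨ ∃ i, r.eval w = some i ∧ d.rel s i q

/-- The working description of evaluation. Since `Past` is vacuous for the empty ranker, it covers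
the first boundary position and all later ones uniformly. -/
theorem Ranker.eval_concat_eq_some_iff {r : Ranker α} {p : BoundaryPos α} {w : List α} {i : ℕ} :
    Ranker.eval (r ++ [p]) w = some i ↔ w[i]? = some p.letter ∧ Past w p.dir true r i ∧
      ∀ j, w[j]? = some p.letter → Past w p.dir true r j → p.dir.rel false i j := by
  by_cases hr : r = []
  · subst hr
    simpa [Past, Ranker.eval] using BoundaryPos.eval_eq_some_iff
  · rw [Ranker.eval_concat hr]
    cases h : r.eval w with
    | none => simp [Past, hr, h]
    | some q => simp [Past, hr, h, BoundaryPos.evalFrom_eq_some_iff]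

theorem Past.of_eval {w : List α} {d : Dir} {s : Bool} {r : Ranker α} {q i : ℕ}
    (h : Past w d s r q) (hi : r.eval w = some i) : d.rel s i q := by
  rcases h with rfl | ⟨j, hj, hjq⟩
  · simp [Ranker.eval] at hi
  · rw [hi] at hj
    cases hj
    exact hjq

theorem Past.trans {w : List α} {d : Dir} {s : Bool} {r : Ranker α} {q q' : ℕ}
    (h : Past w d s r q) (hq : d.rel false q q') : Past w d s r q' := by
  rcases h with h | ⟨i, hi, hiq⟩
  · exact Or.inl h
  · exact Or.inr ⟨i, hi, by simpa using hiq.trans hq⟩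

/-- A position with the right letter beyond `r(w)` makes the extension of `r` defined. -/
theorem Ranker.exists_eval_concat {r : Ranker α} {d : Dir} {a : α} {w : List α} {j : ℕ}
    (hj : w[j]? = some a) (hr : Past w d true r j) :
    ∃ i, Ranker.eval (r ++ [⟨d, a⟩]) w = some i ∧ d.rel false i j := by
  -- The first candidate in direction d is the last one in the opposite direction.
  obtain ⟨i, ⟨hi, hri⟩, hmax⟩ := d.flip.exists_max
    (fun i => w[i]? = some a ∧ Past w d true r i) (N := w.length)
    (fun i h => lt_length_of_getElem? h.1) ⟨j, hj, hr⟩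
  have hmin : ∀ k, w[k]? = some a → Past w d true r k → d.rel false i k :=
    fun k hk hrk => Dir.flip_rel.1 (hmax k ⟨hk, hrk⟩)
  exact ⟨i, Ranker.eval_concat_eq_some_iff.2 ⟨hi, hri, hmin⟩, hmin j hj hr⟩

theorem Ranker.eval_isSome_of_concat {r : Ranker α} {p : BoundaryPos α} {w : List α}
    (h : (Ranker.eval (r ++ [p]) w).isSome) : r = [] ∨ (r.eval w).isSome := by
  obtain ⟨i, hi⟩ := Option.isSome_iff_exists.1 h
  rcases (Ranker.eval_concat_eq_some_iff.1 hi).2.1 with h | ⟨j, hj, -⟩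
  · exact Or.inl h
  · exact Or.inr (by simp [hj])

end Eval

/-! ### Blocks of rankers -/

/-- The number of blocks of `r` after it is extended by a boundary position of direction `d`. -/
def Ranker.extBlocks (d : Dir) (r : Ranker α) : ℕ :=
  r.blocks + if r.lastDir = some d then 0 else 1

theorem Ranker.lastDir_concat (r : Ranker α) (p : BoundaryPos α) :
    Ranker.lastDir (r ++ [p]) = some p.dir := by
  simp [Ranker.lastDir]

theorem Ranker.blocks_concat (r : Ranker α) (p : BoundaryPos α) :
    Ranker.blocks (r ++ [p]) = r.extBlocks p.dir := by
  induction r with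
  | nil => simp [Ranker.blocks, Ranker.extBlocks, Ranker.lastDir]
  | cons q qs ih =>
    cases qs with
    | nil => simp [Ranker.blocks, Ranker.extBlocks, Ranker.lastDir, add_comm]
    | cons q' qs =>
      simp only [Ranker.extBlocks, Ranker.lastDir, List.cons_append, Ranker.blocks,
        List.getLast?_cons_cons] at ih ⊢
      rw [ih, add_assoc]
      rfl

theorem Ranker.extBlocks_concat_self (d : Dir) (a : α) (r : Ranker α) :
    Ranker.extBlocks d (r ++ [⟨d, a⟩]) = r.extBlocks d := by
  rw [Ranker.extBlocks, Ranker.lastDir_concat, Ranker.blocks_concat]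
  simp

theorem Ranker.extBlocks_concat_of_ne {d : Dir} {p : BoundaryPos α} (h : p.dir ≠ d)
    (r : Ranker α) : Ranker.extBlocks d (r ++ [p]) = r.extBlocks p.dir + 1 := by
  rw [Ranker.extBlocks, Ranker.lastDir_concat, Ranker.blocks_concat]
  simp [h]

theorem Ranker.extBlocks_le (d : Dir) (r : Ranker α) : r.extBlocks d ≤ r.blocks + 1 := by
  unfold Ranker.extBlocks
  split_ifs <;> omega

theorem Ranker.blocks_le_extBlocks (d : Dir) (r : Ranker α) : r.blocks ≤ r.extBlocks d :=
  Nat.le_add_right _ _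

theorem Ranker.one_le_blocks {r : Ranker α} (hr : r ≠ []) : 1 ≤ r.blocks := by
  induction r using List.reverseRecOn with
  | nil => exact absurd rfl hr
  | append_singleton r p ih =>
    rw [Ranker.blocks_concat, Ranker.extBlocks]
    by_cases h : r = []
    · simp [h, Ranker.lastDir]
    · have := ih h
      omega

theorem Ranker.one_le_extBlocks (d : Dir) (r : Ranker α) : 1 ≤ r.extBlocks d := by
  by_cases h : r = []
  · simp [h, Ranker.extBlocks, Ranker.lastDir]
  · exact (Ranker.one_le_blocks h).trans (r.blocks_le_extBlocks d)

/-! ### Agreement of two words on rankers -/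

section Agree

variable [DecidableEq α]

theorem mem_rankersStar {m n : ℕ} {w : List α} {r : Ranker α} :
    r ∈ rankersStar m n w ↔ r.blocks ≤ m ∧ r.length ≤ n ∧ (r.eval w).isSome := by
  simp only [rankersStar, rankers, Set.mem_iUnion, Set.mem_Icc, Set.mem_ofPred_eq, exists_prop]
  constructor
  · rintro ⟨i, ⟨-, hi⟩, j, ⟨-, hj⟩, rfl, rfl, h⟩
    exact ⟨hi, hj, h⟩
  · rintro ⟨hm, hn, h⟩
    have hr : r ≠ [] := by
      rintro rfl
      simp [Ranker.eval] at h
    exact ⟨_, ⟨Ranker.one_le_blocks hr, hm⟩, _, ⟨List.length_pos_iff.2 hr, hn⟩, rfl, rfl, h⟩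

/-- The words `u` and `v` agree on definedness and on the relevant order types of rankers with at
most `m` blocks and length at most `n`. -/
structure Agree (m n : ℕ) (u v : List α) : Prop where
  isSome_iff : ∀ r : Ranker α, r.blocks ≤ m → r.length ≤ n →
    ((r.eval u).isSome ↔ (r.eval v).isSome)
  compare_eq : ∀ (r r' : Ranker α) (i i' j j' : ℕ), r.blocks ≤ m → r.length ≤ n →
    r'.length + 1 ≤ n → (r'.blocks + 1 ≤ m ∨ r'.blocks ≤ m ∧ r.lastDir ≠ r'.lastDir) →
    r.eval u = some i → r'.eval u = some i' → r.eval v = some j → r'.eval v = some j' →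
    compare i i' = compare j j'

/-- Defined rankers are nonempty and have at least one block, so the truncated subtractions `m - 1`
and `n - 1` are harmless. -/
theorem agree_iff {m n : ℕ} {u v : List α} :
    (rankersStar m n u = rankersStar m n v ∧
      (∀ r ∈ rankersStar m n u, ∀ r' ∈ rankersStar (m - 1) (n - 1) u,
        ordOn u r r' = ordOn v r r') ∧
      (∀ r ∈ rankersStar m n u, ∀ r' ∈ rankersStar m (n - 1) u,
        r.lastDir ≠ r'.lastDir → ordOn u r r' = ordOn v r r')) ↔ Agree m n u v := by
  constructor
  · rintro ⟨ha, hb, hc⟩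
    refine ⟨fun r hm hn => ?_, fun r r' i i' j j' hm hn hn' h hi hi' hj hj' => ?_⟩
    · have := Set.ext_iff.1 ha r
      simpa [mem_rankersStar, hm, hn] using this
    · have hr : r ∈ rankersStar m n u := mem_rankersStar.2 ⟨hm, hn, by simp [hi]⟩
      have key : ordOn u r r' = ordOn v r r' := by
        rcases h with h | ⟨h, hd⟩
        · exact hb r hr r' (mem_rankersStar.2 ⟨by omega, by omega, by simp [hi']⟩)
        · exact hc r hr r' (mem_rankersStar.2 ⟨by omega, by omega, by simp [hi']⟩) hd
      simpa [ordOn, hi, hi', hj, hj'] using key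
  · intro h
    have ha : rankersStar m n u = rankersStar m n v := by
      ext r
      simp only [mem_rankersStar]
      constructor
      · rintro ⟨hm, hn, hs⟩
        exact ⟨hm, hn, (h.isSome_iff r hm hn).1 hs⟩
      · rintro ⟨hm, hn, hs⟩
        exact ⟨hm, hn, (h.isSome_iff r hm hn).2 hs⟩
    have key : ∀ r ∈ rankersStar m n u, ∀ r' : Ranker α, r'.length ≤ n - 1 →
        (r'.eval u).isSome → (r'.blocks + 1 ≤ m ∨ r'.blocks ≤ m ∧ r.lastDir ≠ r'.lastDir) →
        ordOn u r r' = ordOn v r r' := by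
      intro r hr r' hn' hs' hd
      obtain ⟨hm, hn, hs⟩ := mem_rankersStar.1 hr
      have hr' : r' ≠ [] := by
        rintro rfl
        simp [Ranker.eval] at hs'
      have hpos : 0 < r'.length := List.length_pos_iff.2 hr'
      obtain ⟨i, hi⟩ := Option.isSome_iff_exists.1 hs
      obtain ⟨i', hi'⟩ := Option.isSome_iff_exists.1 hs'
      obtain ⟨j, hj⟩ := Option.isSome_iff_exists.1 ((h.isSome_iff r hm hn).1 hs)
      obtain ⟨j', hj'⟩ := Option.isSome_iff_exists.1
        ((h.isSome_iff r' (by omega) (by omega)).1 hs')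
      simpa [ordOn, hi, hi', hj, hj'] using
        h.compare_eq r r' i i' j j' hm hn (by omega) hd hi hi' hj hj'
    refine ⟨ha, fun r hr r' hr' => ?_, fun r hr r' hr' hd => ?_⟩
    · obtain ⟨hm', hn', hs'⟩ := mem_rankersStar.1 hr'
      have : 1 ≤ r'.blocks := Ranker.one_le_blocks (by rintro rfl; simp [Ranker.eval] at hs')
      exact key r hr r' hn' hs' (Or.inl (by omega))
    · obtain ⟨hm', hn', hs'⟩ := mem_rankersStar.1 hr'
      exact key r hr r' hn' hs' (Or.inr ⟨hm', hd⟩)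

theorem Agree.symm {m n : ℕ} {u v : List α} (h : Agree m n u v) : Agree m n v u :=
  ⟨fun r hm hn => (h.isSome_iff r hm hn).symm,
    fun r r' i i' j j' hm hn hn' hd hi hi' hj hj' =>
      (h.compare_eq r r' j j' i i' hm hn hn' hd hj hj' hi hi').symm⟩

theorem Agree.mono {m n m' n' : ℕ} {u v : List α} (h : Agree m n u v) (hm : m' ≤ m)
    (hn : n' ≤ n) : Agree m' n' u v :=
  ⟨fun r h1 h2 => h.isSome_iff r (h1.trans hm) (h2.trans hn),
    fun r r' i i' j j' h1 h2 h3 h4 => h.compare_eq r r' i i' j j' (h1.trans hm) (h2.trans hn)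
      (h3.trans hn) (h4.imp (fun h => h.trans hm) fun h => ⟨h.1.trans hm, h.2⟩)⟩

theorem Agree.exists_eval {m n : ℕ} {u v : List α} (h : Agree m n u v) {r : Ranker α} {i : ℕ}
    (hm : r.blocks ≤ m) (hn : r.length ≤ n) (hi : r.eval u = some i) :
    ∃ j, r.eval v = some j :=
  Option.isSome_iff_exists.1 ((h.isSome_iff r hm hn).1 (by simp [hi]))

/-! ### The invariant of the game -/

/-- Position `p` of `u` and position `q` of `v` carry the same letter, and `q` inherits from `p`
every comparison with a ranker that has at most `m` blocks and length at most `n` once it is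
extended towards the position. -/
structure Sim (m n : ℕ) (u v : List α) (p q : ℕ) : Prop where
  letter : ∃ a, u[p]? = some a ∧ v[q]? = some a
  past : ∀ (d : Dir) (s : Bool) (r : Ranker α), r.extBlocks d ≤ m → r.length + 1 ≤ n →
    Past u d s r p → Past v d s r q

theorem Sim.mono {m n m' n' : ℕ} {u v : List α} {p q : ℕ} (h : Sim m n u v p q) (hm : m' ≤ m)
    (hn : n' ≤ n) : Sim m' n' u v p q :=
  ⟨h.letter, fun d s r h1 h2 => h.past d s r (h1.trans hm) (h2.trans hn)⟩

/-- For a defined ranker, failing to be beyond it in one direction means being beyond it in the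
other, with strictness exchanged. Turning the direction adds at most one block. -/
theorem Sim.swap {m n : ℕ} {u v : List α} {p q : ℕ} (hA : Agree m n u v)
    (h : Sim (m + 1) n u v p q) : Sim m n v u q p := by
  refine ⟨h.letter.imp fun _ => And.symm, fun d s r hm hn hp => ?_⟩
  rcases hp with hr | ⟨j, hj, hjq⟩
  · exact Or.inl hr
  · have hb := r.blocks_le_extBlocks d
    obtain ⟨i, hi⟩ := hA.symm.exists_eval (hb.trans hm) (by omega) hj
    refine Or.inr ⟨i, hi, ?_⟩
    by_contra hc
    have h2 := (h.past d.flip (!s) r ((r.extBlocks_le _).trans (by omega)) hn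
      (Or.inr ⟨i, hi, Dir.flip_rel.2 (Dir.not_rel.1 hc)⟩)).of_eval hj
    exact Dir.not_rel.2 (Dir.flip_rel.1 h2) hjq

/-- Every position `p` of `u` is matched by a position of `v` that is the value of a ranker whose
value on `u` does not exceed `p` in the prescribed direction. -/
theorem Agree.exists_sim {m n : ℕ} {u v : List α} (h : Agree m n u v) (hm : 1 ≤ m) (hn : 1 ≤ n)
    (d : Dir) {p : ℕ} {a : α} (hp : u[p]? = some a) :
    ∃ (ρ : Ranker α) (i j : ℕ), ρ.eval u = some i ∧ ρ.eval v = some j ∧ ρ.extBlocks d ≤ m ∧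
      ρ.length ≤ n ∧ d.rel false i p ∧ Sim m n u v p j := by
  -- If p is the value of a ranker with a block and a step to spare, that ranker's value on v is the
  -- match, and condition (b) gives every comparison.
  by_cases hex : ∃ r : Ranker α, r.blocks + 1 ≤ m ∧ r.length + 1 ≤ n ∧ r.eval u = some p
  · obtain ⟨r, hrm, hrn, hr⟩ := hex
    obtain ⟨j, hj⟩ := h.exists_eval (by omega) (by omega) hr
    refine ⟨r, p, j, hr, hj, (r.extBlocks_le d).trans hrm, by omega, d.rel_refl p, ?_, ?_⟩
    · rcases List.eq_nil_or_concat r with rfl | ⟨r₀, b, rfl⟩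
      · simp [Ranker.eval] at hr
      · rw [List.concat_eq_append] at hr hj
        have h1 := (Ranker.eval_concat_eq_some_iff.1 hr).1
        exact ⟨b.letter, h1, (Ranker.eval_concat_eq_some_iff.1 hj).1⟩
    · rintro e s r' hm' hn' (hr' | ⟨i', hi', hrel⟩)
      · exact Or.inl hr'
      · have hb := r'.blocks_le_extBlocks e
        obtain ⟨j', hj'⟩ := h.exists_eval (hb.trans hm') (by omega) hi'
        have := h.compare_eq r' r i' p j' j (hb.trans hm') (by omega) hrn (Or.inl hrm) hi' hr
          hj' hj
        exact Or.inr ⟨j', hj', (compare_eq_compare_iff_rel.1 this s).1 hrel⟩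
  -- Otherwise, extend every affordable ranker lying strictly before p by a step to the letter of p.
  -- On u these extensions do not pass p; the match is the value farthest in direction d that they
  -- take on v.
  · let S : Ranker α → Prop := fun r => r.extBlocks d ≤ m ∧ r.length + 1 ≤ n ∧ Past u d true r p
    have hS : ∀ r, S r → ∃ i j, Ranker.eval (r ++ [⟨d, a⟩]) u = some i ∧
        Ranker.eval (r ++ [⟨d, a⟩]) v = some j ∧ d.rel false i p := by
      rintro r ⟨h1, h2, h3⟩
      obtain ⟨i, hi, hip⟩ := Ranker.exists_eval_concat hp h3
      obtain ⟨j, hj⟩ := h.exists_eval (by rw [Ranker.blocks_concat]; exact h1) (by simpa) hi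
      exact ⟨i, j, hi, hj, hip⟩
    obtain ⟨q, ⟨r, hr, hq⟩, hmax⟩ := d.exists_max
      (fun j => ∃ r, S r ∧ Ranker.eval (r ++ [⟨d, a⟩]) v = some j) (N := v.length)
      (by
        rintro j ⟨r, -, hj⟩
        exact lt_length_of_getElem? (Ranker.eval_concat_eq_some_iff.1 hj).1)
      (by
        have h0 : S [] := ⟨by simpa [Ranker.extBlocks, Ranker.blocks, Ranker.lastDir] using hm,
          by simpa using hn, Or.inl rfl⟩
        obtain ⟨_, j, _, hj, _⟩ := hS _ h0
        exact ⟨j, [], h0, hj⟩)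
    have hlow : ∀ r', S r' → Past v d true r' q := by
      intro r' hr'
      obtain ⟨_, j, _, hj, _⟩ := hS r' hr'
      exact (Ranker.eval_concat_eq_some_iff.1 hj).2.1.trans (hmax j ⟨r', hr', hj⟩)
    have hqa : v[q]? = some a := (Ranker.eval_concat_eq_some_iff.1 hq).1
    obtain ⟨i, j, hi, hj, hip⟩ := hS r hr
    obtain rfl : q = j := by simpa [hq] using hj
    have hext : Ranker.extBlocks d (r ++ [⟨d, a⟩]) ≤ m := by
      rw [Ranker.extBlocks_concat_self]
      exact hr.1
    have hlen : (r ++ [⟨d, a⟩] : Ranker α).length ≤ n := by simpa using hr.2.1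
    refine ⟨_, i, q, hi, hq, hext, hlen, hip, ⟨a, hp, hqa⟩, ?_⟩
    rintro e s r' hm' hn' (hr' | ⟨i', hi', hrel⟩)
    · exact Or.inl hr'
    have hb := r'.blocks_le_extBlocks e
    obtain ⟨j', hj'⟩ := h.exists_eval (hb.trans hm') (by omega) hi'
    refine Or.inr ⟨j', hj', ?_⟩
    by_cases hed : e = d
    · subst hed
      by_cases hstr : e.rel true i' p
      · have := (hlow r' ⟨hm', hn', Or.inr ⟨i', hi', hstr⟩⟩).of_eval hj'
        cases s
        · exact this.weaken
        · exact this
      cases s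
      case true => exact absurd hrel hstr
      -- The remaining case is a ranker hitting p itself. If its last step has direction `e`, it is
      -- one of the extensions above; if not, it has a block to spare, which `hex` excludes.
      obtain rfl : i' = p := (Dir.rel_or_eq hrel).resolve_left hstr
      rcases List.eq_nil_or_concat r' with rfl | ⟨r₀, b, rfl⟩
      · simp [Ranker.eval] at hi'
      rw [List.concat_eq_append] at *
      by_cases hbe : b.dir = e
      · obtain ⟨f, c⟩ := b
        subst hbe
        obtain ⟨hc, hpast, -⟩ := Ranker.eval_concat_eq_some_iff.1 hi'
        obtain rfl : a = c := by simpa [hp] using hc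
        rw [Ranker.extBlocks_concat_self] at hm'
        simp only [List.length_append, List.length_singleton] at hn'
        exact (Ranker.eval_concat_eq_some_iff.1 hj').2.2 q hqa
          (hlow r₀ ⟨hm', by omega, hpast⟩)
      · refine absurd ⟨_, ?_, hn', hi'⟩ hex
        rw [Ranker.blocks_concat, ← Ranker.extBlocks_concat_of_ne hbe]
        exact hm'
    -- Against d, the extension that defines the match lies on u weakly before p, hence before `r'`;
    -- conditions (b) and (c) carry this order to v.
    · obtain rfl : e = d.flip := Dir.eq_flip_of_ne (Ne.symm hed)
      have hd : r'.blocks + 1 ≤ m ∨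
          r'.blocks ≤ m ∧ Ranker.lastDir (r ++ [⟨d, a⟩]) ≠ r'.lastDir := by
        by_cases hl : r'.lastDir = some d.flip
        · refine Or.inr ⟨hb.trans hm', ?_⟩
          rw [Ranker.lastDir_concat, hl]
          simpa using d.flip_ne.symm
        · left
          simpa [Ranker.extBlocks, hl] using hm'
      have hcmp := h.compare_eq _ r' i i' q j' ((Ranker.blocks_le_extBlocks d _).trans hext)
        hlen hn' hd hi hi' hq hj'
      rw [Dir.flip_rel] at hrel ⊢
      refine (compare_eq_compare_iff_rel.1 hcmp s).1 ?_
      simpa using hip.trans hrel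

/-- One move of the game: the invariant survives with one position less of ranker length. -/
theorem Sim.forth {m n : ℕ} {u v : List α} {p q p' : ℕ} (h : Sim m (n + 1) u v p q)
    (hA : Agree m n u v) (hm : 1 ≤ m) (hn : 1 ≤ n) (hp' : p' < u.length) :
    ∃ q', compare p p' = compare q q' ∧ Sim m n u v p' q' := by
  by_cases hpp : p' = p
  · subst hpp
    exact ⟨q, by simp, h.mono le_rfl (Nat.le_succ n)⟩
  · obtain ⟨d, hd⟩ := Dir.exists_rel_of_ne hpp
    obtain ⟨ρ, i, j, hi, hj, hρm, hρn, hip, hsim⟩ :=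
      hA.exists_sim hm hn d (List.getElem?_eq_getElem hp')
    refine ⟨j, compare_swap_eq ?_, hsim⟩
    -- The ranker ρ may have full length n; this is why the old invariant is needed at n + 1.
    have hjq := (h.past d true ρ hρm (by omega)
      (Or.inr ⟨i, hi, by simpa using hip.trans hd⟩)).of_eval hj
    refine (compare_eq_compare_iff_rel (d := d)).2 fun s => ?_
    cases s
    · exact iff_of_true hd.weaken hjq.weaken
    · exact iff_of_true hd hjq

/-- The invariant for assignments of both variables. -/
structure AssignSim (m n : ℕ) (u v : List α) (s t : Fin 2 → ℕ) : Prop where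
  sim : ∀ x, Sim m n u v (s x) (t x)
  compare_eq : ∀ x y, compare (s x) (s y) = compare (t x) (t y)

theorem AssignSim.swap {m n : ℕ} {u v : List α} {s t : Fin 2 → ℕ} (hA : Agree m n u v)
    (h : AssignSim (m + 1) n u v s t) : AssignSim m n v u t s :=
  ⟨fun x => (h.sim x).swap hA, fun x y => (h.compare_eq x y).symm⟩

/-- With two variables only one pebble stays in place, so the move has to respect the order to the
single position held by `x + 1`, the other variable. -/
theorem AssignSim.forth {m n : ℕ} {u v : List α} {s t : Fin 2 → ℕ}
    (h : AssignSim m (n + 1) u v s t) (hA : Agree m n u v) (hm : 1 ≤ m) (hn : 1 ≤ n)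
    (x : Fin 2) {i : ℕ} (hi : i < u.length) :
    ∃ j, j < v.length ∧ AssignSim m n u v (Function.update s x i) (Function.update t x j) := by
  obtain ⟨j, hcmp, hsim⟩ := (h.sim (x + 1)).forth hA hm hn hi
  have hne : x + 1 ≠ x := by
    clear hcmp hsim
    revert x
    decide
  have hother : ∀ y, y ≠ x → y = x + 1 := by
    clear hcmp hsim hne
    revert x
    decide
  refine ⟨j, ?_, fun y => ?_, fun y z => ?_⟩
  · obtain ⟨a, -, ha⟩ := hsim.letter
    exact lt_length_of_getElem? ha
  · by_cases hy : y = x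
    · simpa [hy] using hsim
    · simpa [hy] using (h.sim y).mono le_rfl (Nat.le_succ n)
  · by_cases hy : y = x <;> by_cases hz : z = x
    · simp [hy, hz]
    · simpa [hy, hother z hz, hne] using compare_swap_eq hcmp
    · simpa [hother y hy, hz, hne] using hcmp
    · simpa [hy, hz] using h.compare_eq y z

end Agree

/-! ### Formulas -/

namespace Formula

theorem holds_congr {w : List α} (φ : Formula α) {s t : Fin 2 → ℕ}
    (h : ∀ x ∈ φ.freeVars, s x = t x) : φ.Holds w s ↔ φ.Holds w t := by
  induction φ generalizing s t with
  | letter a x => simp [Holds, h x (by simp [freeVars])]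
  | lt x y => simp [Holds, h x (by simp [freeVars]), h y (by simp [freeVars])]
  | eq x y => simp [Holds, h x (by simp [freeVars]), h y (by simp [freeVars])]
  | neg φ ih => exact not_congr (ih h)
  | and φ ψ ihφ ihψ =>
    exact and_congr (ihφ fun x hx => h x (Finset.mem_union_left _ hx))
      (ihψ fun x hx => h x (Finset.mem_union_right _ hx))
  | or φ ψ ihφ ihψ =>
    exact or_congr (ihφ fun x hx => h x (Finset.mem_union_left _ hx))
      (ihψ fun x hx => h x (Finset.mem_union_right _ hx))
  | quant Q x φ ih =>
    have key : ∀ i, φ.Holds w (Function.update s x i) ↔ φ.Holds w (Function.update t x i) := by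
      refine fun i => ih fun y hy => ?_
      by_cases hyx : y = x
      · simp [hyx]
      · simpa [hyx] using h y (Finset.mem_erase.2 ⟨hyx, hy⟩)
    cases Q <;> simp only [Holds, key]

/-- Flipping the polarity dualizes every quantifier below, so dualizing the one above as well leaves
all alternations in place. -/
theorem blocksAux_dual (φ : Formula α) (pos : Bool) (Q : Quant) :
    φ.blocksAux (!pos) (some Q.dual) = φ.blocksAux pos (some Q) := by
  induction φ generalizing pos Q with
  | letter a x => rfl
  | lt x y => rfl
  | eq x y => rfl
  | neg φ ih => exact ih _ _
  | and φ ψ ihφ ihψ => simp only [blocksAux, ihφ, ihψ]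
  | or φ ψ ihφ ihψ => simp only [blocksAux, ihφ, ihψ]
  | quant Q' x φ ih =>
    have := ih pos Quant.ex
    have := ih pos Quant.all
    cases pos <;> cases Q <;> cases Q' <;> simp_all [blocksAux, Quant.dual]

theorem blocksAux_all (φ : Formula α) (pos : Bool) :
    φ.blocksAux pos (some Quant.all) = φ.blocksAux (!pos) (some Quant.ex) := by
  simpa [Quant.dual] using φ.blocksAux_dual (!pos) Quant.ex

end Formula

/-! ### Ranker agreement implies logical equivalence -/

section Transfer

variable [DecidableEq α]

open Formula in
/-- Formulas whose quantifiers, read from an existential block on, have at most `k` further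
alternations are preserved along the invariant. -/
theorem AssignSim.holds (φ : Formula α) {k n : ℕ} {u v : List α} {s t : Fin 2 → ℕ}
    (hA : Agree (k + 1) (n + 1) u v) (h : AssignSim (k + 1) (n + 1) u v s t)
    (hd : φ.depth ≤ n) :
    (φ.blocksAux true (some Quant.ex) ≤ k → φ.Holds u s → φ.Holds v t) ∧
      (φ.blocksAux false (some Quant.ex) ≤ k → φ.Holds v t → φ.Holds u s) := by
  induction φ generalizing k n u v s t with
  | letter a x =>
    obtain ⟨b, hb, hb'⟩ := (h.sim x).letter
    simp [Holds, hb, hb']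
  | lt x y =>
    have := compare_eq_compare_iff.1 (h.compare_eq x y)
    simp [Holds, this.1]
  | eq x y =>
    have := compare_eq_compare_iff.1 (h.compare_eq x y)
    simp only [Holds]
    omega
  | neg φ ih =>
    obtain ⟨h1, h2⟩ := ih hA h hd
    exact ⟨fun hb => mt (h2 hb), fun hb => mt (h1 hb)⟩
  | and φ ψ ihφ ihψ =>
    obtain ⟨h1, h2⟩ := ihφ hA h (le_of_max_le_left hd)
    obtain ⟨h3, h4⟩ := ihψ hA h (le_of_max_le_right hd)
    exact ⟨fun hb => And.imp (h1 (le_of_max_le_left hb)) (h3 (le_of_max_le_right hb)),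
      fun hb => And.imp (h2 (le_of_max_le_left hb)) (h4 (le_of_max_le_right hb))⟩
  | or φ ψ ihφ ihψ =>
    obtain ⟨h1, h2⟩ := ihφ hA h (le_of_max_le_left hd)
    obtain ⟨h3, h4⟩ := ihψ hA h (le_of_max_le_right hd)
    exact ⟨fun hb => Or.imp (h1 (le_of_max_le_left hb)) (h3 (le_of_max_le_right hb)),
      fun hb => Or.imp (h2 (le_of_max_le_left hb)) (h4 (le_of_max_le_right hb))⟩
  | quant Q x φ ih =>
    obtain ⟨n, rfl⟩ : ∃ n', n = n' + 1 := ⟨n - 1, by simp only [depth] at hd; omega⟩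
    have hd' : φ.depth ≤ n := by simpa [depth] using hd
    have hA' : Agree (k + 1) (n + 1) u v := hA.mono le_rfl (Nat.le_succ _)
    have forth : ∀ i < u.length, ∃ j < v.length,
        (φ.blocksAux true (some Quant.ex) ≤ k →
          φ.Holds u (Function.update s x i) → φ.Holds v (Function.update t x j)) ∧
        (φ.blocksAux false (some Quant.ex) ≤ k →
          φ.Holds v (Function.update t x j) → φ.Holds u (Function.update s x i)) := by
      intro i hi
      obtain ⟨j, hj, hs⟩ := h.forth hA' (by omega) (by omega) x hi
      exact ⟨j, hj, ih hA' hs hd'⟩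
    -- Answering a move in v reverses the invariant and uses up one block, which the alternation
    -- counted by `blocksAux` supplies.
    have back : 1 ≤ k → ∀ j < v.length, ∃ i < u.length,
        (φ.blocksAux true (some Quant.ex) ≤ k - 1 →
          φ.Holds v (Function.update t x j) → φ.Holds u (Function.update s x i)) ∧
        (φ.blocksAux false (some Quant.ex) ≤ k - 1 →
          φ.Holds u (Function.update s x i) → φ.Holds v (Function.update t x j)) := by
      intro hk j hj
      obtain ⟨k, rfl⟩ : ∃ k', k = k' + 1 := ⟨k - 1, by omega⟩
      have hs := h.swap (hA.mono (Nat.le_succ _) le_rfl)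
      have hA'' : Agree (k + 1) (n + 1) v u := (hA'.mono (Nat.le_succ _) le_rfl).symm
      obtain ⟨i, hi, hs'⟩ := hs.forth hA'' (by omega) (by omega) x hj
      exact ⟨i, hi, ih hA'' hs' hd'⟩
    cases Q with
    | ex =>
      refine ⟨fun hb => ?_, fun hb => ?_⟩
      · rintro ⟨i, hi, hφ⟩
        obtain ⟨j, hj, h1, -⟩ := forth i hi
        exact ⟨j, hj, h1 (by simpa [blocksAux] using hb) hφ⟩
      · rintro ⟨j, hj, hφ⟩
        simp [blocksAux, Quant.dual, blocksAux_all] at hb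
        obtain ⟨i, hi, h1, -⟩ := back (by omega) j hj
        exact ⟨i, hi, h1 (by omega) hφ⟩
    | all =>
      refine ⟨fun hb hφ j hj => ?_, fun hb hφ i hi => ?_⟩
      · simp [blocksAux, blocksAux_all] at hb
        obtain ⟨i, hi, -, h2⟩ := back (by omega) j hj
        exact h2 (by omega) (hφ i hi)
      · obtain ⟨j, hj, -, h2⟩ := forth i hi
        exact h2 (by simpa [blocksAux, Quant.dual] using hb) (hφ j hj)

-- The opening move. No pebble has been placed, so any direction will do in `Agree.exists_sim`. Only
-- x can be free, so both variables may be put on the chosen position and their order is trivially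
-- preserved.
open Formula in
theorem Agree.exists_holds {k n : ℕ} {u v : List α} (hA : Agree (k + 1) (n + 1) u v)
    {φ : Formula α} {x : Fin 2} (hfree : φ.freeVars.erase x = ∅) (hd : φ.depth ≤ n)
    (σ : Fin 2 → ℕ) {i : ℕ} (hi : i < u.length) :
    ∃ j < v.length,
      (φ.blocksAux true (some Quant.ex) ≤ k →
        φ.Holds u (Function.update σ x i) → φ.Holds v (Function.update σ x j)) ∧
      (φ.blocksAux false (some Quant.ex) ≤ k →
        φ.Holds v (Function.update σ x j) → φ.Holds u (Function.update σ x i)) := by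
  obtain ⟨_, _, j, _, _, _, _, _, hsim⟩ :=
    hA.exists_sim (by omega) (by omega) Dir.right (List.getElem?_eq_getElem hi)
  have hconst : ∀ (w : List α) (l : ℕ),
      φ.Holds w (Function.update σ x l) ↔ φ.Holds w fun _ => l := by
    refine fun w l => φ.holds_congr fun y hy => ?_
    have : y = x := by
      by_contra hyx
      have := Finset.mem_erase.2 ⟨hyx, hy⟩
      simp [hfree] at this
    simp [this]
  refine ⟨j, ?_, ?_⟩
  · obtain ⟨a, -, ha⟩ := hsim.letter
    exact lt_length_of_getElem? ha
  · simp only [hconst]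
    exact AssignSim.holds φ hA ⟨fun _ => hsim, fun _ _ => by simp⟩ hd

-- Until the first quantifier is met no position is fixed. `Agree` is symmetric, so negations and an
-- outermost universal quantifier exchange the words at no cost in blocks.
open Formula in
theorem Agree.holds_imp {m n : ℕ} (φ : Formula α) {u v : List α} (hA : Agree m n u v)
    (σ : Fin 2 → ℕ) (pos : Bool) (hfree : φ.freeVars = ∅) (hb : φ.blocksAux pos none ≤ m)
    (hd : φ.depth ≤ n) : φ.Holds u σ → φ.Holds v σ := by
  induction φ generalizing u v pos with
  | letter a x => simp [freeVars] at hfree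
  | lt x y => simp [freeVars] at hfree
  | eq x y => simp [freeVars] at hfree
  | neg φ ih => exact mt (ih hA.symm (!pos) hfree hb hd)
  | and φ ψ ihφ ihψ =>
    obtain ⟨h1, h2⟩ := Finset.union_eq_empty.1 hfree
    exact And.imp (ihφ hA pos h1 (le_of_max_le_left hb) (le_of_max_le_left hd))
      (ihψ hA pos h2 (le_of_max_le_right hb) (le_of_max_le_right hd))
  | or φ ψ ihφ ihψ =>
    obtain ⟨h1, h2⟩ := Finset.union_eq_empty.1 hfree
    exact Or.imp (ihφ hA pos h1 (le_of_max_le_left hb) (le_of_max_le_left hd))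
      (ihψ hA pos h2 (le_of_max_le_right hb) (le_of_max_le_right hd))
  | quant Q x φ ih =>
    obtain ⟨n, rfl⟩ : ∃ n', n = n' + 1 := ⟨n - 1, by simp only [depth] at hd; omega⟩
    obtain ⟨k, rfl⟩ : ∃ k, m = k + 1 := ⟨m - 1, by simp [blocksAux] at hb; omega⟩
    have hd' : φ.depth ≤ n := by simpa [depth] using hd
    cases Q with
    | ex =>
      rintro ⟨i, hi, hφ⟩
      obtain ⟨j, hj, h1, -⟩ := hA.exists_holds hfree hd' σ hi
      refine ⟨j, hj, h1 ?_ hφ⟩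
      cases pos <;> simp [blocksAux, Quant.dual, blocksAux_all] at hb <;> omega
    | all =>
      intro hφ j hj
      obtain ⟨i, hi, -, h2⟩ := hA.symm.exists_holds hfree hd' σ hj
      refine h2 ?_ (hφ i hi)
      cases pos <;> simp [blocksAux, Quant.dual, blocksAux_all] at hb <;> omega

theorem Agree.equiv2 {m n : ℕ} {u v : List α} (hA : Agree m n u v) : Equiv2 m n u v :=
  fun φ ⟨hfree, hb, hd⟩ =>
    ⟨hA.holds_imp φ _ true hfree hb hd, hA.symm.holds_imp φ _ true hfree hb hd⟩

end Transfer

/-! ### Defining rankers by formulas -/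

namespace Formula

/-- The variable `x` precedes `y` in direction `d`. -/
def dirRel : Dir → (strict : Bool) → Fin 2 → Fin 2 → Formula α
  | Dir.right, true, x, y => lt x y
  | Dir.right, false, x, y => neg (lt y x)
  | Dir.left, true, x, y => lt y x
  | Dir.left, false, x, y => neg (lt x y)

theorem holds_dirRel {w : List α} {σ : Fin 2 → ℕ} {d : Dir} {s : Bool} {x y : Fin 2} :
    (dirRel d s x y : Formula α).Holds w σ ↔ d.rel s (σ x) (σ y) := by
  cases d <;> cases s <;> simp [dirRel, Holds, Dir.rel]

theorem depth_dirRel (d : Dir) (s : Bool) (x y : Fin 2) :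
    (dirRel d s x y : Formula α).depth = 0 := by
  cases d <;> cases s <;> rfl

theorem blocksAux_dirRel (d : Dir) (s : Bool) (x y : Fin 2) (pos : Bool) (last : Option Quant) :
    (dirRel d s x y : Formula α).blocksAux pos last = 0 := by
  cases d <;> cases s <;> rfl

theorem freeVars_dirRel (d : Dir) (s : Bool) (x y : Fin 2) :
    (dirRel d s x y : Formula α).freeVars = {x, y} := by
  cases d <;> cases s <;> simp [dirRel, freeVars, Finset.pair_comm]

/-- The formula saying that `x` is beyond the value of a ranker in direction `d`. The ranker is
given by the list of its boundary positions in reverse order. -/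
def beyondRev : Dir → (strict : Bool) → List (BoundaryPos α) → Fin 2 → Formula α
  | _, _, [], x => eq x x
  | d, s, p :: r, x =>
    if p.dir = d then
      quant Quant.ex (x + 1) (and (dirRel d s (x + 1) x)
        (and (letter p.letter (x + 1)) (beyondRev d true r (x + 1))))
    else
      neg (quant Quant.ex (x + 1) (and (dirRel p.dir (!s) (x + 1) x)
        (and (letter p.letter (x + 1)) (beyondRev p.dir true r (x + 1)))))

/-- The formula saying that `x` is beyond the value of the ranker `r` in direction `d`. -/
def beyond (d : Dir) (s : Bool) (r : Ranker α) (x : Fin 2) : Formula α :=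
  beyondRev d s r.reverse x

theorem beyond_nil (d : Dir) (s : Bool) (x : Fin 2) :
    (beyond d s [] x : Formula α) = eq x x := by
  simp [beyond, beyondRev]

theorem beyond_concat_self (s : Bool) (r : Ranker α) (p : BoundaryPos α) (x : Fin 2) :
    beyond p.dir s (r ++ [p]) x = quant Quant.ex (x + 1) (and (dirRel p.dir s (x + 1) x)
      (and (letter p.letter (x + 1)) (beyond p.dir true r (x + 1)))) := by
  simp [beyond, beyondRev]

theorem beyond_concat_of_ne {d : Dir} {p : BoundaryPos α} (h : p.dir ≠ d) (s : Bool)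
    (r : Ranker α) (x : Fin 2) :
    beyond d s (r ++ [p]) x = neg (beyond p.dir (!s) (r ++ [p]) x) := by
  simp [beyond, beyondRev, h]

theorem depth_beyond (d : Dir) (s : Bool) (r : Ranker α) (x : Fin 2) :
    (beyond d s r x).depth = r.length := by
  induction r using List.reverseRecOn generalizing d s x with
  | nil => simp [beyond_nil, depth]
  | append_singleton r p ih =>
    have key : ∀ s, (beyond p.dir s (r ++ [p]) x).depth = r.length + 1 := by
      simp [beyond_concat_self, depth, depth_dirRel, ih]
    by_cases h : p.dir = d
    · subst h
      simp [key]
    · simp [beyond_concat_of_ne h, depth, key]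

theorem freeVars_beyond (d : Dir) (s : Bool) (r : Ranker α) (x : Fin 2) :
    (beyond d s r x).freeVars = {x} := by
  induction r using List.reverseRecOn generalizing d s x with
  | nil => simp [beyond_nil, freeVars]
  | append_singleton r p ih =>
    have key : ∀ s, (beyond p.dir s (r ++ [p]) x).freeVars = {x} := by
      intro s
      simp only [beyond_concat_self, freeVars, freeVars_dirRel, ih]
      revert x
      decide
    by_cases h : p.dir = d
    · subst h
      simp [key]
    · simp [beyond_concat_of_ne h, freeVars, key]

/-- A negation is inserted exactly where the direction changes, so each maximal block of the
extended ranker becomes one quantifier block. The leading one continues the existential block above,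
hence the `+ 1`. -/
theorem blocksAux_beyond (d : Dir) (s : Bool) (r : Ranker α) (x : Fin 2) :
    (beyond d s r x).blocksAux true (some Quant.ex) + 1 ≤ r.extBlocks d := by
  induction r using List.reverseRecOn generalizing d s x with
  | nil => simp [beyond_nil, blocksAux, Ranker.extBlocks, Ranker.lastDir]
  | append_singleton r p ih =>
    have hr := ih p.dir true (x + 1)
    by_cases h : p.dir = d
    · subst h
      rw [Ranker.extBlocks_concat_self p.dir p.letter r]
      simpa [beyond_concat_self, blocksAux, blocksAux_dirRel] using hr
    · rw [Ranker.extBlocks_concat_of_ne h]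
      simp [beyond_concat_of_ne h, beyond_concat_self, blocksAux, blocksAux_dirRel, Quant.dual,
        blocksAux_all]
      omega

/-- In the direction of its last step, being beyond a ranker means having some admissible occurrence
of its last letter behind, since the value is the first of these. The opposite direction is the
negation, which is correct only if the ranker is defined. -/
theorem holds_beyond [DecidableEq α] {w : List α} {d : Dir} {s : Bool} {r : Ranker α}
    (hr : r = [] ∨ (r.eval w).isSome) {x : Fin 2} {σ : Fin 2 → ℕ} :
    (beyond d s r x).Holds w σ ↔ Past w d s r (σ x) := by
  induction r using List.reverseRecOn generalizing d s x σ with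
  | nil => simp [beyond_nil, Holds, Past]
  | append_singleton r p ih =>
    have hs : (Ranker.eval (r ++ [p]) w).isSome := hr.resolve_left (by simp)
    obtain ⟨i, hi⟩ := Option.isSome_iff_exists.1 hs
    have hi' := Ranker.eval_concat_eq_some_iff.1 hi
    have hx : x ≠ x + 1 := by
      revert x
      decide
    have key : ∀ s, (beyond p.dir s (r ++ [p]) x).Holds w σ ↔ p.dir.rel s i (σ x) := by
      intro s
      simp only [beyond_concat_self, Holds, holds_dirRel, ih (Ranker.eval_isSome_of_concat hs),
        Function.update_self, Function.update_of_ne hx]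
      constructor
      · rintro ⟨j, -, hjx, hja, hjr⟩
        simpa using (hi'.2.2 j hja hjr).trans hjx
      · intro h
        exact ⟨i, lt_length_of_getElem? hi'.1, h, hi'.1, hi'.2.1⟩
    have hpast : Past w d s (r ++ [p]) (σ x) ↔ d.rel s i (σ x) := by
      simp [Past, hi]
    rw [hpast]
    by_cases h : p.dir = d
    · subst h
      exact key s
    · rw [beyond_concat_of_ne h, Holds, key, Dir.not_rel, Dir.eq_flip_of_ne h, Dir.flip_rel,
        Bool.not_not]

/-- The sentence saying that some `a` lies beyond `r` in direction `d` and, in the opposite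
direction, beyond `r'`. -/
def between (d : Dir) (a : α) (r : Ranker α) (s : Bool) (r' : Ranker α) : Formula α :=
  quant Quant.ex 0 (and (letter a 0) (and (beyond d true r 0) (beyond d.flip s r' 0)))

theorem between_mem {m n : ℕ} {d : Dir} {a : α} {r r' : Ranker α} {s : Bool}
    (hm : r.extBlocks d ≤ m) (hn : r.length + 1 ≤ n) (hm' : r'.extBlocks d.flip ≤ m)
    (hn' : r'.length + 1 ≤ n) : between d a r s r' ∈ SentencesFO2 α m n := by
  refine ⟨?_, ?_, ?_⟩
  · simp [between, freeVars, freeVars_beyond]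
  · have h1 := blocksAux_beyond d true r 0
    have h2 := blocksAux_beyond d.flip s r' 0
    simp [between, blocks, blocksAux]
    omega
  · simp [between, depth, depth_beyond]
    omega

theorem models_between [DecidableEq α] {w : List α} {d : Dir} {a : α} {r r' : Ranker α}
    {s : Bool} (hr : r = [] ∨ (r.eval w).isSome) (hr' : r' = [] ∨ (r'.eval w).isSome) :
    Models w (between d a r s r') ↔
      ∃ j, w[j]? = some a ∧ Past w d true r j ∧ Past w d.flip s r' j := by
  simp only [Models, between, Holds, holds_beyond hr, holds_beyond hr', Function.update_self]
  constructor
  · rintro ⟨j, -, h⟩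
    exact ⟨j, h⟩
  · rintro ⟨j, h⟩
    exact ⟨j, lt_length_of_getElem? h.1, h⟩

end Formula

theorem Equiv2.symm {m n : ℕ} {u v : List α} (h : Equiv2 m n u v) : Equiv2 m n v u :=
  fun φ hφ => (h φ hφ).symm

/-! ### Logical equivalence implies ranker agreement -/

section Definability

variable [DecidableEq α]

open Formula

theorem models_between_nil_iff {w : List α} {d : Dir} {a : α} {r : Ranker α}
    (hr : r = [] ∨ (r.eval w).isSome) :
    Models w (between d a r true []) ↔ (Ranker.eval (r ++ [⟨d, a⟩]) w).isSome := by
  rw [models_between hr (Or.inl rfl)]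
  constructor
  · rintro ⟨j, hj, hjr, -⟩
    obtain ⟨i, hi, -⟩ := Ranker.exists_eval_concat hj hjr
    simp [hi]
  · intro h
    obtain ⟨i, hi⟩ := Option.isSome_iff_exists.1 h
    have := Ranker.eval_concat_eq_some_iff.1 hi
    exact ⟨i, this.1, this.2.1, Or.inl rfl⟩

/-- Some a beyond r lies before `r'` exactly when the first such a does. -/
theorem models_between_iff_rel {w : List α} {d : Dir} {a : α} {r r' : Ranker α} {s : Bool}
    {i i' : ℕ} (hi : Ranker.eval (r ++ [⟨d, a⟩]) w = some i) (hi' : r'.eval w = some i') :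
    Models w (between d a r s r') ↔ d.rel s i i' := by
  have hc := Ranker.eval_concat_eq_some_iff.1 hi
  rw [models_between (Ranker.eval_isSome_of_concat (p := ⟨d, a⟩) (by simp [hi]))
    (Or.inr (by simp [hi']))]
  constructor
  · rintro ⟨j, hj, hjr, hjr'⟩
    simpa using (hc.2.2 j hj hjr).trans (Dir.flip_rel.1 (hjr'.of_eval hi'))
  · intro h
    exact ⟨i, hc.1, hc.2.1, Or.inr ⟨i', hi', Dir.flip_rel.2 h⟩⟩

theorem Equiv2.isSome_of_isSome {m n : ℕ} {u v : List α} (h : Equiv2 m n u v) (r : Ranker α)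
    (hm : r.blocks ≤ m) (hn : r.length ≤ n) (hr : (r.eval u).isSome) : (r.eval v).isSome := by
  induction r using List.reverseRecOn with
  | nil => simp [Ranker.eval] at hr
  | append_singleton r p ih =>
    rw [Ranker.blocks_concat] at hm
    simp only [List.length_append, List.length_singleton] at hn
    have hu := Ranker.eval_isSome_of_concat hr
    have hv : r = [] ∨ (Ranker.eval r v).isSome :=
      hu.imp_right (ih ((Ranker.blocks_le_extBlocks _ r).trans hm) (by omega))
    refine (models_between_nil_iff hv).1 ((h _ (between_mem hm hn ?_ (by simp; omega))).1
      ((models_between_nil_iff hu).2 hr))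
    simpa [Ranker.extBlocks, Ranker.blocks, Ranker.lastDir] using
      (Ranker.one_le_extBlocks p.dir r).trans hm

theorem Equiv2.agree {m n : ℕ} {u v : List α} (h : Equiv2 m n u v) : Agree m n u v := by
  refine ⟨fun r hm hn => ⟨h.isSome_of_isSome r hm hn, h.symm.isSome_of_isSome r hm hn⟩, ?_⟩
  intro r r' i i' j j' hm hn hn' hd hi hi' hj hj'
  rcases List.eq_nil_or_concat r with rfl | ⟨r, ⟨d, a⟩, rfl⟩
  · simp [Ranker.eval] at hi
  rw [List.concat_eq_append] at *
  rw [Ranker.blocks_concat] at hm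
  simp only [List.length_append, List.length_singleton] at hn
  -- Both alternatives give this bound: either there is a block to spare for turning against d, or
  -- `r'` already ends in that direction.
  have hm' : r'.extBlocks d.flip ≤ m := by
    rcases hd with hd | ⟨hb, hd⟩
    · exact (r'.extBlocks_le _).trans hd
    · rw [Ranker.lastDir_concat] at hd
      have hl : r'.lastDir = some d.flip := by
        rcases List.eq_nil_or_concat r' with rfl | ⟨r', b, rfl⟩
        · simp [Ranker.eval] at hi'
        · rw [List.concat_eq_append, Ranker.lastDir_concat] at hd ⊢
          exact congrArg some (Dir.eq_flip_of_ne fun hdb => hd (congrArg some hdb))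
      simpa [Ranker.extBlocks, hl] using hb
  refine (compare_eq_compare_iff_rel (d := d)).2 fun s => ?_
  rw [← models_between_iff_rel hi hi', ← models_between_iff_rel hj hj']
  exact h _ (between_mem hm hn hm' hn')

end Definability

end FO2

theorem mainTheorem2 {α : Type*} [Finite α] [DecidableEq α] (u v : List α) (m n : ℕ)
    (hmn : m ≤ n) :
    (FO2.rankersStar m n u = FO2.rankersStar m n v ∧
      (∀ r ∈ FO2.rankersStar m n u, ∀ r' ∈ FO2.rankersStar (m - 1) (n - 1) u,
        FO2.ordOn u r r' = FO2.ordOn v r r') ∧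
      (∀ r ∈ FO2.rankersStar m n u, ∀ r' ∈ FO2.rankersStar m (n - 1) u,
        r.lastDir ≠ r'.lastDir → FO2.ordOn u r r' = FO2.ordOn v r r')) ↔
    FO2.Equiv2 m n u v :=
  FO2.agree_iff.trans ⟨fun h => h.equiv2, fun h => h.agree⟩
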